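/- **Theorem.** Put $\binom{m}{j}=0$ whenever $m<0$ (and, as usual, whenever $0\le m<j$). Let $\{u_n\}_{n\ge 0}$ be one of the following $15$ Apéry-like sequences of integers. *Six sequences of the second kind:* - **A**: $u_n=\sum_{k=0}^n\binom nk^3$; - **B**: $u_n=\sum_{k=0}^n(-1)^k3^{n-3k}\binom n{3k}\binom{3k}{2k}\binom{2k}k$; - **C**: $u_n=\sum_{k=0}^n\binom nk^2\binom{2k}k$; - **D**: $u_n=\sum_{k=0}^n\binom nk^2\binom{n+k}k$; - **E**: $u_n=\sum_{k=0}^n4^{n-2k}\binom n{2k}\binom{2k}k^2$; - **F**: $u_n=\sum_{k=0}^n(-1)^k8^{n-k}\binom nk\sum_{j=0}^k\binom kj^3$. *Nine sequences of the first kind:* - $(\delta)$: $u_n=\sum_{k=0}^n(-1)^k3^{n-3k}\binom n{3k}\binom{n+k}k\binom{3k}{2k}\binom{2k}k$; - $(\eta)$: $u_n=\sum_{k=0}^n(-1)^k\binom nk^3\left(\binom{4n-5k-1}{3n}+\binom{4n-5k}{3n}\right)$; - $(\alpha)$: $u_n=\sum_{k=0}^n\binom nk^2\binom{2k}k\binom{2n-2k}{n-k}$;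 - $(\epsilon)$: $u_n=\sum_{k=0}^n\binom nk^2\binom{2k}n^2$; - $(\zeta)$: $u_n=\sum_{k=0}^n\sum_{l=0}^n\binom nk^2\binom nl\binom kl\binom{k+l}n$; - $(\gamma)$: $u_n=\sum_{k=0}^n\binom nk^2\binom{n+k}k^2$; - $s_7$: $u_n=\sum_{k=0}^n\binom nk^2\binom{n+k}k\binom{2k}n$; - $s_{10}$: $u_n=\sum_{k=0}^n\binom nk^4$; - $s_{18}$: $u_n=\sum_{k=0}^n(-1)^k\binom nk\binom{2k}k\binom{2n-2k}{n-k}\left(\binom{2n-3k-1}n+\binom{2n-3k}n\right)$. Let $v_n(x)=\sum_{k=0}^n\binom nk(-x)^{n-k}u_k$ be the binomial transform of $\{u_n\}_{n\ge 0}$. For an integer $\alpha$, let $M_\alpha=\gcd(v_1(\alpha),v_2(\alpha),v_3(\alpha))$ if the sequence is of the second kind, and $M_\alpha=\gcd(v_1(\alpha),v_2(\alpha),v_3(\alpha),v_4(\alpha))$ if it is of the first kind. For a positive integer $M$, let $M^{(sf)}$ be its largest square-free divisor. Then, for every integer $\alpha$ and all integers $n\ge 0$, $$u_n\equiv\alpha^n\pmod{M_\alpha^{(sf)}}.$$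 -/

import Mathlib

/-- The binomial coefficient "`m` choose `j`" for an integer `m` and a natural number `j`, with the
convention that it is `0` whenever `m < 0`. -/
def binomZ (m : ℤ) (j : ℕ) : ℤ := if 0 ≤ m then (m.toNat.choose j : ℤ) else 0

/-- The six Apéry-like sequences of the second kind (Zagier). -/
inductive SecondKind
  | A | B | C | D | E | F

/-- The nine Apéry-like sequences of the first kind (Almkvist–Zudilin and Cooper). -/
inductive FirstKind
  | delta | eta | alpha | epsilon | zeta | gamma | s7 | s10 | s18

/-- The Apéry-like sequences of the second kind.  In the rows `B` and `E` the exponents are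
natural number subtractions, but every term with `n < 3 * k` (respectively `n < 2 * k`) has a
vanishing binomial factor. -/
def SecondKind.seq : SecondKind → ℕ → ℤ
  | .A, n => ∑ k ∈ Finset.range (n + 1), (n.choose k : ℤ) ^ 3
  | .B, n => ∑ k ∈ Finset.range (n + 1),
      (-1 : ℤ) ^ k * 3 ^ (n - 3 * k) * (n.choose (3 * k) : ℤ) * ((3 * k).choose (2 * k) : ℤ)
        * ((2 * k).choose k : ℤ)
  | .C, n => ∑ k ∈ Finset.range (n + 1), (n.choose k : ℤ) ^ 2 * ((2 * k).choose k : ℤ)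
  | .D, n => ∑ k ∈ Finset.range (n + 1), (n.choose k : ℤ) ^ 2 * ((n + k).choose k : ℤ)
  | .E, n => ∑ k ∈ Finset.range (n + 1),
      (4 : ℤ) ^ (n - 2 * k) * (n.choose (2 * k) : ℤ) * ((2 * k).choose k : ℤ) ^ 2
  | .F, n => ∑ k ∈ Finset.range (n + 1),
      (-1 : ℤ) ^ k * 8 ^ (n - k) * (n.choose k : ℤ)
        * ∑ j ∈ Finset.range (k + 1), (k.choose j : ℤ) ^ 3

/-- The Apéry-like sequences of the first kind.  In the row `delta` the exponent is a natural
number subtraction, but every term with `n < 3 * k` has a vanishing binomial factor. -/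
def FirstKind.seq : FirstKind → ℕ → ℤ
  | .delta, n => ∑ k ∈ Finset.range (n + 1),
      (-1 : ℤ) ^ k * 3 ^ (n - 3 * k) * (n.choose (3 * k) : ℤ) * ((n + k).choose k : ℤ)
        * ((3 * k).choose (2 * k) : ℤ) * ((2 * k).choose k : ℤ)
  | .eta, n => ∑ k ∈ Finset.range (n + 1),
      (-1 : ℤ) ^ k * (n.choose k : ℤ) ^ 3
        * (binomZ (4 * n - 5 * k - 1) (3 * n) + binomZ (4 * n - 5 * k) (3 * n))
  | .alpha, n => ∑ k ∈ Finset.range (n + 1),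
      (n.choose k : ℤ) ^ 2 * ((2 * k).choose k : ℤ) * ((2 * n - 2 * k).choose (n - k) : ℤ)
  | .epsilon, n => ∑ k ∈ Finset.range (n + 1), (n.choose k : ℤ) ^ 2 * ((2 * k).choose n : ℤ) ^ 2
  | .zeta, n => ∑ k ∈ Finset.range (n + 1), ∑ l ∈ Finset.range (n + 1),
      (n.choose k : ℤ) ^ 2 * (n.choose l : ℤ) * (k.choose l : ℤ) * ((k + l).choose n : ℤ)
  | .gamma, n => ∑ k ∈ Finset.range (n + 1), (n.choose k : ℤ) ^ 2 * ((n + k).choose k : ℤ) ^ 2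
  | .s7, n => ∑ k ∈ Finset.range (n + 1),
      (n.choose k : ℤ) ^ 2 * ((n + k).choose k : ℤ) * ((2 * k).choose n : ℤ)
  | .s10, n => ∑ k ∈ Finset.range (n + 1), (n.choose k : ℤ) ^ 4
  | .s18, n => ∑ k ∈ Finset.range (n + 1),
      (-1 : ℤ) ^ k * (n.choose k : ℤ) * ((2 * k).choose k : ℤ) * ((2 * n - 2 * k).choose (n - k) : ℤ)
        * (binomZ (2 * n - 3 * k - 1) n + binomZ (2 * n - 3 * k) n)

/-- The binomial transform `v_n(x) = ∑_{k=0}^n (n choose k) (-x)^(n-k) u_k` at an integer `x`. -/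
def binomialTransform (u : ℕ → ℤ) (n : ℕ) (x : ℤ) : ℤ :=
  ∑ k ∈ Finset.range (n + 1), (n.choose k : ℤ) * (-x) ^ (n - k) * u k

/-- One of the 15 Apéry-like sequences: of the second kind or of the first kind. -/
inductive AperyLike
  | second (s : SecondKind)
  | first (s : FirstKind)

/-- The terms of an Apéry-like sequence. -/
def AperyLike.seq : AperyLike → ℕ → ℤ
  | .second s => s.seq
  | .first s => s.seq

/-- `M_α`: the greatest common divisor of `v_1(α), v_2(α), v_3(α)` for the second kind, and of
`v_1(α), v_2(α), v_3(α), v_4(α)` for the first kind. -/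
def AperyLike.M (s : AperyLike) (α : ℤ) : ℕ :=
  match s with
  | .second t => (Finset.Icc 1 3).gcd fun i => (binomialTransform t.seq i α).natAbs
  | .first t => (Finset.Icc 1 4).gcd fun i => (binomialTransform t.seq i α).natAbs

/-- The largest square-free divisor of a positive integer `M`. -/
def squarefreeFactor (M : ℕ) : ℕ := (M.divisors.filter Squarefree).sup id

/-! It suffices to work modulo each prime p dividing M_α. Since u_0 = 1, binomial inversion turns p
∣ v_i(α) for i = 1, ..., N into u_i ≡ α^i mod p for i ≤ N (`cast_eq_pow_of_transform`). Hence α ≡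
u_1, and p divides u_2 - u_1^2 and u_3 - u_1^3. These are explicit integers which leave only p = 2
and, for most sequences, one further prime, 3 or 5. What remains is a finite list of congruences u_n
≡ u_1^n mod p, valid for all n.

Three mechanisms prove them. When the summand is multiplicative in base-p digits (Lucas), u_{pm+r} ≡
u_m u_r, and Fermat's c^p = c extends u_r ≡ c^r from r < p to all n (`eq_pow_of_lucas`). Modulo 2,
most sums collapse because C(2k,k) is even for k > 0; modulo 3, Fermat, the binomial theorem or
divisibility of the terms suffices for A, B, F and δ. For η mod 5 and s_18 mod 3, every term
vanishes when p ∤ n, while u_{pm} ≡ u_m. Finally, η mod 2 satisfies u_n ≡ u_{⌊n/2⌋} for n ≥ 2. -/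

/-! ### Lucas' congruence and digitwise factorisation of sums. -/

instance fact_prime_five : Fact (Nat.Prime 5) := ⟨by norm_num⟩

/-- Lucas' congruence, allowing a single carry that annihilates both sides. -/
theorem cast_choose_lucas {p : ℕ} [Fact p.Prime] (m j : ℕ) {a b : ℕ} (hb : b < p)
    (ha : a < p + b) :
    (((p * m + a).choose (p * j + b) : ℕ) : ZMod p) = (m.choose j : ZMod p) * (a.choose b : ZMod p) := by
  have hp : 0 < p := (Fact.out : p.Prime).pos
  have key : ∀ m j a b : ℕ, a < p → b < p →
      (((p * m + a).choose (p * j + b) : ℕ) : ZMod p)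
        = (m.choose j : ZMod p) * (a.choose b : ZMod p) := by
    intro m j a b ha hb
    have h := (ZMod.natCast_eq_natCast_iff _ _ p).2
      (Choose.choose_modEq_choose_mod_mul_choose_div_nat (n := p * m + a) (k := p * j + b) (p := p))
    rw [h, Nat.mul_add_mod, Nat.mul_add_mod, Nat.mod_eq_of_lt ha, Nat.mod_eq_of_lt hb,
      Nat.mul_add_div hp, Nat.mul_add_div hp, Nat.div_eq_of_lt ha, Nat.div_eq_of_lt hb]
    push_cast
    simp [mul_comm]
  rcases lt_or_ge a p with h | h
  · exact key m j a b h hb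
  · obtain ⟨c, rfl⟩ := Nat.exists_eq_add_of_le h
    -- The carry leaves the last digit c < b on top, so the left side vanishes; Lucas applied to C(p
    -- + c, b) shows that the right side does too.
    have hc : c.choose b = 0 := Nat.choose_eq_zero_of_lt (by omega)
    have h1 := key (m + 1) j c b (by omega) hb
    have h2 := key 1 0 c b (by omega) hb
    rw [hc] at h1 h2
    rw [mul_add, mul_one, add_assoc] at h1
    rw [mul_one, mul_zero, zero_add] at h2
    rw [h1, h2]
    simp

theorem sum_range_mul_of_digits {R : Type*} [CommSemiring R] {p : ℕ} {h a b : ℕ → R}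
    (hh : ∀ j s, s < p → h (p * j + s) = a j * b s) (M : ℕ) :
    ∑ k ∈ Finset.range (p * M), h k
      = (∑ j ∈ Finset.range M, a j) * ∑ s ∈ Finset.range p, b s := by
  induction M with
  | zero => simp
  | succ M ih =>
    rw [mul_add, mul_one, Finset.sum_range_add, ih, Finset.sum_range_succ, add_mul, Finset.mul_sum _ _ (a M)]
    congr 1
    exact Finset.sum_congr rfl fun s hs => hh M s (Finset.mem_range.1 hs)

theorem sum_range_eq_of_vanish {R : Type*} [AddCommMonoid R] {f : ℕ → R} {n N : ℕ} (hN : n < N)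
    (h0 : ∀ k, n < k → f k = 0) :
    ∑ k ∈ Finset.range (n + 1), f k = ∑ k ∈ Finset.range N, f k := by
  refine Finset.sum_subset (fun k hk => ?_) fun k _ hk => h0 k ?_
  · simp only [Finset.mem_range] at *; omega
  · simp only [Finset.mem_range] at *; omega

/-- Padding with vanishing terms up to p(m + 1) makes the range a full rectangle of digit pairs (j,
s), over which the sum factors. -/
theorem sum_range_lucas {R : Type*} [CommSemiring R] {p m r : ℕ} {h a b : ℕ → R} (hr : r < p)
    (hh : ∀ j s, s < p → h (p * j + s) = a j * b s)
    (h0 : ∀ k, p * m + r < k → h k = 0) (b0 : ∀ k, r < k → b k = 0) :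
    ∑ k ∈ Finset.range (p * m + r + 1), h k
      = (∑ j ∈ Finset.range (m + 1), a j) * ∑ s ∈ Finset.range (r + 1), b s := by
  rw [sum_range_eq_of_vanish (N := p * (m + 1)) (by rw [mul_add]; omega) h0,
    sum_range_mul_of_digits hh, sum_range_eq_of_vanish hr b0]

/-- By induction u_{pm+r} = c^m c^r, which equals c^{pm+r} because c^p = c. -/
theorem eq_pow_of_lucas {p : ℕ} [Fact p.Prime] {u : ℕ → ZMod p} {c : ZMod p}
    (hu : ∀ m r, r < p → u (p * m + r) = u m * u r) (hc : ∀ r < p, u r = c ^ r) (n : ℕ) :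
    u n = c ^ n := by
  have hp : p.Prime := Fact.out
  induction n using Nat.strong_induction_on with
  | _ n ih =>
    rcases lt_or_ge n p with h | h
    · exact hc n h
    · have hr := Nat.mod_lt n hp.pos
      have hn := Nat.div_add_mod n p
      rw [← hn, hu _ _ hr, ih _ (Nat.div_lt_self (by omega) hp.one_lt), hc _ hr, pow_add, pow_mul,
        ZMod.pow_card]

theorem sum_eq_pow_of_lucas {p : ℕ} [Fact p.Prime] {f : ℕ → ℕ → ZMod p} {c : ZMod p}
    (hf : ∀ m j r s, r < p → s < p → f (p * m + r) (p * j + s) = f m j * f r s)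
    (h0 : ∀ n k, n < k → f n k = 0)
    (hc : ∀ r < p, ∑ k ∈ Finset.range (r + 1), f r k = c ^ r) (n : ℕ) :
    ∑ k ∈ Finset.range (n + 1), f n k = c ^ n :=
  eq_pow_of_lucas (u := fun n => ∑ k ∈ Finset.range (n + 1), f n k)
    (fun m r hr => sum_range_lucas hr (fun j s hs => hf m j r s hr hs) (h0 _) (h0 _)) hc n

/-! ### Digit factorisation of the binomial factors in the summands. -/

section LucasTerms

variable {p : ℕ} [Fact p.Prime] (m j : ℕ) {r s : ℕ}

theorem lucas_choose (hr : r < p) (hs : s < p) :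
    (((p * m + r).choose (p * j + s) : ℕ) : ZMod p) = m.choose j * r.choose s :=
  cast_choose_lucas m j hs (by omega)

theorem lucas_choose_add (hr : r < p) (hs : s < p) :
    (((p * m + r + (p * j + s)).choose (p * j + s) : ℕ) : ZMod p)
      = (m + j).choose j * (r + s).choose s := by
  rw [← cast_choose_lucas (m + j) j hs (by omega)]
  congr 2; ring

theorem lucas_central (hs : s < p) :
    (((2 * (p * j + s)).choose (p * j + s) : ℕ) : ZMod p)
      = (2 * j).choose j * (2 * s).choose s := by
  rw [← cast_choose_lucas (2 * j) j hs (by omega)]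
  congr 2; ring

/-- The factor C(n,k) kills every case with a borrow in n - k or a truncated subtraction; otherwise
n - k has digits m - j and r - s. -/
theorem lucas_choose_mul_central_sub (hr : r < p) (hs : s < p) :
    (((p * m + r).choose (p * j + s) : ℕ) : ZMod p)
        * (((2 * (p * m + r) - 2 * (p * j + s)).choose ((p * m + r) - (p * j + s)) : ℕ) : ZMod p)
      = (m.choose j * ((2 * m - 2 * j).choose (m - j) : ℕ))
        * (r.choose s * ((2 * r - 2 * s).choose (r - s) : ℕ)) := by
  rw [lucas_choose m j hr hs]
  rcases lt_or_ge r s with h | h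
  · simp [Nat.choose_eq_zero_of_lt h]
  rcases lt_or_ge m j with h' | h'
  · simp [Nat.choose_eq_zero_of_lt h']
  obtain ⟨d, rfl⟩ := Nat.exists_eq_add_of_le h
  obtain ⟨e, rfl⟩ := Nat.exists_eq_add_of_le h'
  have h1 : p * (j + e) + (s + d) - (p * j + s) = p * e + d := by
    rw [mul_add]; omega
  simp only [← Nat.mul_sub]
  rw [h1, lucas_central e (by omega)]
  simp only [Nat.add_sub_cancel_left]
  ring

/-- C(2k,n) alone need not factor, as doubling the digit s may carry. The factor C(n,k) restricts to
s ≤ r, so 2s < p + r and the carry is harmless. -/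
theorem lucas_choose_mul_choose_two_mul (hr : r < p) (hs : s < p) :
    (((p * m + r).choose (p * j + s) : ℕ) : ZMod p)
        * (((2 * (p * j + s)).choose (p * m + r) : ℕ) : ZMod p)
      = (m.choose j * ((2 * j).choose m : ℕ)) * (r.choose s * ((2 * s).choose r : ℕ)) := by
  rw [lucas_choose m j hr hs]
  rcases lt_or_ge r s with h | h
  · simp [Nat.choose_eq_zero_of_lt h]
  have := cast_choose_lucas (p := p) (2 * j) m (a := 2 * s) hr (by omega)
  rw [show 2 * (p * j + s) = p * (2 * j) + 2 * s by ring, this]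
  ring

theorem lucas_choose_mul_choose_add (i : ℕ) {t : ℕ} (hr : r < p) (hs : s < p) (ht : t < p) :
    (((p * m + r).choose (p * j + s) : ℕ) : ZMod p)
        * (((p * j + s + (p * i + t)).choose (p * m + r) : ℕ) : ZMod p)
      = (m.choose j * ((j + i).choose m : ℕ)) * (r.choose s * ((s + t).choose r : ℕ)) := by
  rw [lucas_choose m j hr hs]
  rcases lt_or_ge r s with h | h
  · simp [Nat.choose_eq_zero_of_lt h]
  have := cast_choose_lucas (p := p) (j + i) m (a := s + t) hr (by omega)
  rw [show p * j + s + (p * i + t) = p * (j + i) + (s + t) by ring, this]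
  ring

end LucasTerms

/-! ### Sequences with the Lucas property modulo 3 or 5. -/

section CongruencesByLucas

theorem C_mod_three (n : ℕ) : ((SecondKind.C.seq n : ℤ) : ZMod 3) = 3 ^ n := by
  simp only [SecondKind.seq]
  push_cast
  refine sum_eq_pow_of_lucas (p := 3)
    (f := fun n k => (n.choose k : ZMod 3) ^ 2 * ((2 * k).choose k : ℕ)) ?_ ?_ ?_ n
  · intro m j r s hr hs
    simp only [lucas_choose m j hr hs, lucas_central j hs]
    ring
  · intro n k h
    simp [Nat.choose_eq_zero_of_lt h]
  · decide

theorem D_mod_five (n : ℕ) : ((SecondKind.D.seq n : ℤ) : ZMod 5) = 3 ^ n := by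
  simp only [SecondKind.seq]
  push_cast
  refine sum_eq_pow_of_lucas (p := 5)
    (f := fun n k => (n.choose k : ZMod 5) ^ 2 * ((n + k).choose k : ℕ)) ?_ ?_ ?_ n
  · intro m j r s hr hs
    simp only [lucas_choose m j hr hs, lucas_choose_add m j hr hs]
    ring
  · intro n k h
    simp [Nat.choose_eq_zero_of_lt h]
  · decide

theorem alpha_mod_three (n : ℕ) : ((FirstKind.alpha.seq n : ℤ) : ZMod 3) = 4 ^ n := by
  simp only [FirstKind.seq]
  push_cast
  rw [← sum_eq_pow_of_lucas (p := 3) (f := fun n k => (n.choose k : ZMod 3)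
    * ((2 * k).choose k : ℕ) * (n.choose k * ((2 * n - 2 * k).choose (n - k) : ℕ))) ?_ ?_ ?_ n]
  · exact Finset.sum_congr rfl fun k _ => by ring
  · intro m j r s hr hs
    simp only [lucas_choose_mul_central_sub m j hr hs, lucas_central j hs]
    rw [lucas_choose m j hr hs]
    ring
  · intro n k h
    simp [Nat.choose_eq_zero_of_lt h]
  · decide

theorem epsilon_mod_three (n : ℕ) : ((FirstKind.epsilon.seq n : ℤ) : ZMod 3) = 4 ^ n := by
  simp only [FirstKind.seq]
  push_cast
  simp only [← mul_pow]
  refine sum_eq_pow_of_lucas (p := 3)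
    (f := fun n k => ((n.choose k : ZMod 3) * ((2 * k).choose n : ℕ)) ^ 2) ?_ ?_ ?_ n
  · intro m j r s hr hs
    simp only [lucas_choose_mul_choose_two_mul m j hr hs]
    ring
  · intro n k h
    simp [Nat.choose_eq_zero_of_lt h]
  · decide

theorem gamma_mod_three (n : ℕ) : ((FirstKind.gamma.seq n : ℤ) : ZMod 3) = 5 ^ n := by
  simp only [FirstKind.seq]
  push_cast
  refine sum_eq_pow_of_lucas (p := 3)
    (f := fun n k => (n.choose k : ZMod 3) ^ 2 * ((n + k).choose k : ℕ) ^ 2) ?_ ?_ ?_ n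
  · intro m j r s hr hs
    simp only [lucas_choose m j hr hs, lucas_choose_add m j hr hs]
    ring
  · intro n k h
    simp [Nat.choose_eq_zero_of_lt h]
  · decide

theorem zeta_mod_three (n : ℕ) : ((FirstKind.zeta.seq n : ℤ) : ZMod 3) = 3 ^ n := by
  simp only [FirstKind.seq]
  push_cast
  refine sum_eq_pow_of_lucas (p := 3) (f := fun n k => ∑ l ∈ Finset.range (n + 1),
    (n.choose k : ZMod 3) ^ 2 * (n.choose l : ℕ) * (k.choose l : ℕ) * ((k + l).choose n : ℕ))
    ?_ ?_ ?_ n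
  · intro m j r s hr hs
    refine sum_range_lucas hr (fun i t ht => ?_) (fun k h => ?_) fun k h => ?_
    · have h1 := lucas_choose_mul_choose_add (p := 3) m j i hr hs ht
      have h2 := lucas_choose (p := 3) m i hr ht
      have h3 := lucas_choose (p := 3) j i hs ht
      have h4 := lucas_choose (p := 3) m j hr hs
      -- One copy of C(n,k) is spent on the possible carry in C(k+l,n) through `h1`; the other is
      -- expanded by `h4`.
      rw [pow_two, mul_right_comm _ _ (((_ : ℕ).choose (3 * i + t) : ℕ) : ZMod 3), h2]
      linear_combination (exp := 1) (((3 * m + r).choose (3 * j + s) : ℕ) : ZMod 3)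
        * (m.choose i * r.choose t) * (((3 * j + s).choose (3 * i + t) : ℕ) : ZMod 3) * h1
        + (m.choose i * r.choose t) * (((3 * j + s).choose (3 * i + t) : ℕ) : ZMod 3)
        * ((m.choose j * ((j + i).choose m : ℕ)) * (r.choose s * ((s + t).choose r : ℕ))) * h4
        + (m.choose i * r.choose t) * ((m.choose j : ZMod 3) * (r.choose s : ZMod 3))
        * ((m.choose j * ((j + i).choose m : ℕ)) * (r.choose s * ((s + t).choose r : ℕ))) * h3
    · simp [Nat.choose_eq_zero_of_lt h]
    · simp [Nat.choose_eq_zero_of_lt h]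
  · intro n k h
    simp [Nat.choose_eq_zero_of_lt h]
  · decide

end CongruencesByLucas

/-! ### Evenness of products containing a hidden central binomial coefficient. -/

section CentralBinomial

theorem cast_central_mod_two {k : ℕ} (hk : k ≠ 0) : (((2 * k).choose k : ℕ) : ZMod 2) = 0 := by
  rw [ZMod.natCast_eq_zero_iff]
  exact Nat.two_dvd_centralBinom_of_one_le (Nat.one_le_iff_ne_zero.2 hk)

/-- C(n,k) C(n+k,k) = C(n+k,2k) C(2k,k). -/
theorem choose_mul_choose_add_mod_two (n : ℕ) {k : ℕ} (hk : k ≠ 0) :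
    (n.choose k : ZMod 2) * ((n + k).choose k : ℕ) = 0 := by
  rcases lt_or_ge n k with h | h
  · simp [Nat.choose_eq_zero_of_lt h]
  have h1 : n.choose k * (n + k).choose k = (n + k).choose (2 * k) * (2 * k).choose k := by
    rw [Nat.choose_mul (by omega), mul_comm]
    congr 2 <;> omega
  rw [← Nat.cast_mul, h1, Nat.cast_mul, cast_central_mod_two hk, mul_zero]

/-- C(2k,n) C(n,k) = C(2k,k) C(k,n-k) for k ≤ n ≤ 2k. -/
theorem choose_mul_choose_two_mul_mod_two (n : ℕ) {k : ℕ} (hk : k ≠ 0) :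
    (n.choose k : ZMod 2) * ((2 * k).choose n : ℕ) = 0 := by
  rcases lt_or_ge n k with h | h
  · simp [Nat.choose_eq_zero_of_lt h]
  rcases lt_or_ge (2 * k) n with h' | h'
  · simp [Nat.choose_eq_zero_of_lt h']
  rw [← Nat.cast_mul, mul_comm (n.choose k), Nat.choose_mul h, Nat.cast_mul,
    cast_central_mod_two hk, zero_mul]

/-- C(k+l,n) C(n,k) = C(k+l,l) C(l,n-k), and C(k,l) C(k+l,l) is even by the previous case. -/
theorem choose_mul_choose_add_choose_mod_two (n k : ℕ) {l : ℕ} (hl : l ≠ 0) :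
    (n.choose k : ZMod 2) * (k.choose l : ℕ) * ((k + l).choose n : ℕ) = 0 := by
  rcases lt_or_ge n k with h | h
  · simp [Nat.choose_eq_zero_of_lt h]
  rcases lt_or_ge k l with h1 | h1
  · simp [Nat.choose_eq_zero_of_lt h1]
  rcases lt_or_ge (k + l) n with h2 | h2
  · simp [Nat.choose_eq_zero_of_lt h2]
  have h3 := Nat.choose_mul (n := k + l) (k := n) (s := k) h
  have h4 := choose_mul_choose_add_mod_two k hl
  rw [← Nat.cast_mul] at h4
  have h5 : (k + l).choose k = (k + l).choose l := Nat.choose_symm_add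
  have h6 : n.choose k * k.choose l * (k + l).choose n
      = (k.choose l * (k + l).choose l) * (k + l - k).choose (n - k) := by
    rw [h5] at h3
    calc _ = k.choose l * ((k + l).choose n * n.choose k) := by ring
      _ = _ := by rw [h3, mul_assoc]
  rw [← Nat.cast_mul, ← Nat.cast_mul, h6, Nat.cast_mul, h4, zero_mul]

theorem pow_three_mod_two (x : ZMod 2) : x ^ 3 = x := by revert x; decide

end CentralBinomial

theorem sum_range_succ_eq_single {R : Type*} [AddCommMonoid R] {f : ℕ → R} (n k : ℕ) (hk : k ≤ n)
    (h : ∀ i ≤ n, i ≠ k → f i = 0) : ∑ i ∈ Finset.range (n + 1), f i = f k :=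
  Finset.sum_eq_single_of_mem k (Finset.mem_range.2 (by omega)) fun i hi hik =>
    h i (Nat.lt_succ_iff.1 (Finset.mem_range.1 hi)) hik

/-! ### Congruences modulo 2, except for η. -/

section ModTwo

theorem A_mod_two (n : ℕ) : ((SecondKind.A.seq n : ℤ) : ZMod 2) = 2 ^ n := by
  simp only [SecondKind.seq]
  push_cast
  simp only [pow_three_mod_two]
  exact_mod_cast congrArg (Nat.cast (R := ZMod 2)) (Nat.sum_range_choose n)

theorem B_mod_two (n : ℕ) : ((SecondKind.B.seq n : ℤ) : ZMod 2) = 3 ^ n := by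
  simp only [SecondKind.seq]
  push_cast
  rw [sum_range_succ_eq_single n 0 (Nat.zero_le _) fun k _ hk => by
    rw [cast_central_mod_two hk, mul_zero]]
  simp

theorem C_mod_two (n : ℕ) : ((SecondKind.C.seq n : ℤ) : ZMod 2) = 3 ^ n := by
  simp only [SecondKind.seq]
  push_cast
  rw [sum_range_succ_eq_single n 0 (Nat.zero_le _) fun k _ hk => by
    rw [cast_central_mod_two hk, mul_zero], show (3 : ZMod 2) = 1 from rfl]
  simp

theorem D_mod_two (n : ℕ) : ((SecondKind.D.seq n : ℤ) : ZMod 2) = 3 ^ n := by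
  simp only [SecondKind.seq]
  push_cast
  rw [sum_range_succ_eq_single n 0 (Nat.zero_le _) fun k _ hk => by
    rw [pow_two, mul_assoc, choose_mul_choose_add_mod_two n hk, mul_zero],
    show (3 : ZMod 2) = 1 from rfl]
  simp

theorem E_mod_two (n : ℕ) : ((SecondKind.E.seq n : ℤ) : ZMod 2) = 4 ^ n := by
  simp only [SecondKind.seq]
  push_cast
  rw [sum_range_succ_eq_single n 0 (Nat.zero_le _) fun k _ hk => by
    rw [cast_central_mod_two hk]; simp]
  simp

theorem F_mod_two (n : ℕ) : ((SecondKind.F.seq n : ℤ) : ZMod 2) = 6 ^ n := by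
  have hA := A_mod_two n
  simp only [SecondKind.seq] at hA ⊢
  push_cast at hA ⊢
  -- As 8 = 0, only k = n survives, leaving the n-th term of A up to a sign that is trivial modulo
  -- 2.
  rw [sum_range_succ_eq_single n n le_rfl fun k hk hkn => by
    rw [show (8 : ZMod 2) = 0 from rfl, zero_pow (by omega)]; simp, hA,
    show (-1 : ZMod 2) = 1 from rfl, show (6 : ZMod 2) = 2 from rfl]
  simp

theorem delta_mod_two (n : ℕ) : ((FirstKind.delta.seq n : ℤ) : ZMod 2) = 3 ^ n := by
  simp only [FirstKind.seq]
  push_cast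
  rw [sum_range_succ_eq_single n 0 (Nat.zero_le _) fun k _ hk => by
    rw [cast_central_mod_two hk, mul_zero]]
  simp

theorem central_mul_central_mod_two {n k : ℕ} (hn : n ≠ 0) (hk : k ≤ n) :
    (((2 * k).choose k : ℕ) : ZMod 2) * ((2 * n - 2 * k).choose (n - k) : ℕ) = 0 := by
  rcases eq_or_ne k 0 with rfl | h
  · have := cast_central_mod_two hn
    simp [this]
  · rw [cast_central_mod_two h, zero_mul]

theorem alpha_mod_two (n : ℕ) : ((FirstKind.alpha.seq n : ℤ) : ZMod 2) = 4 ^ n := by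
  rcases eq_or_ne n 0 with rfl | hn
  · decide
  simp only [FirstKind.seq]
  push_cast
  rw [Finset.sum_eq_zero fun k hk => by
    rw [mul_assoc, central_mul_central_mod_two hn (by simpa [Nat.lt_succ_iff] using hk), mul_zero],
    show (4 : ZMod 2) = 0 from rfl, zero_pow hn]

theorem epsilon_mod_two (n : ℕ) : ((FirstKind.epsilon.seq n : ℤ) : ZMod 2) = 4 ^ n := by
  simp only [FirstKind.seq]
  push_cast
  simp only [← mul_pow]
  rw [sum_range_succ_eq_single n 0 (Nat.zero_le _) fun k _ hk => by
    rw [choose_mul_choose_two_mul_mod_two n hk]; simp, show (4 : ZMod 2) = 0 from rfl]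
  cases n <;> simp

theorem zeta_mod_two (n : ℕ) : ((FirstKind.zeta.seq n : ℤ) : ZMod 2) = 3 ^ n := by
  simp only [FirstKind.seq]
  push_cast
  rw [sum_range_succ_eq_single n n le_rfl, sum_range_succ_eq_single n 0 (Nat.zero_le _),
    show (3 : ZMod 2) = 1 from rfl]
  · simp
  · intro l _ hl
    linear_combination (exp := 1) (n.choose n : ZMod 2) * (n.choose l)
      * choose_mul_choose_add_choose_mod_two n n hl
  · intro k hk hkn
    refine Finset.sum_eq_zero fun l _ => ?_
    rcases eq_or_ne l 0 with rfl | hl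
    · simp [Nat.choose_eq_zero_of_lt (lt_of_le_of_ne hk hkn)]
    · linear_combination (exp := 1) (n.choose k : ZMod 2) * (n.choose l)
        * choose_mul_choose_add_choose_mod_two n k hl

theorem gamma_mod_two (n : ℕ) : ((FirstKind.gamma.seq n : ℤ) : ZMod 2) = 5 ^ n := by
  simp only [FirstKind.seq]
  push_cast
  simp only [← mul_pow]
  rw [sum_range_succ_eq_single n 0 (Nat.zero_le _) fun k _ hk => by
    rw [choose_mul_choose_add_mod_two n hk]; simp, show (5 : ZMod 2) = 1 from rfl]
  simp

theorem s7_mod_two (n : ℕ) : ((FirstKind.s7.seq n : ℤ) : ZMod 2) = 4 ^ n := by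
  simp only [FirstKind.seq]
  push_cast
  rw [sum_range_succ_eq_single n 0 (Nat.zero_le _) fun k _ hk => by
    rw [pow_two, mul_assoc (n.choose k : ZMod 2), choose_mul_choose_add_mod_two n hk]; simp,
    show (4 : ZMod 2) = 0 from rfl]
  cases n <;> simp

theorem s10_mod_two (n : ℕ) : ((FirstKind.s10.seq n : ℤ) : ZMod 2) = 2 ^ n := by
  simp only [FirstKind.seq]
  push_cast
  have h (x : ZMod 2) : x ^ 4 = x := by revert x; decide
  simp only [h]
  exact_mod_cast congrArg (Nat.cast (R := ZMod 2)) (Nat.sum_range_choose n)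

theorem s18_mod_two (n : ℕ) : ((FirstKind.s18.seq n : ℤ) : ZMod 2) = 6 ^ n := by
  rcases eq_or_ne n 0 with rfl | hn
  · decide
  simp only [FirstKind.seq]
  push_cast
  rw [Finset.sum_eq_zero fun k hk => by
    rw [mul_assoc (_ * _) (((2 * k).choose k : ℕ) : ZMod 2),
      central_mul_central_mod_two hn (by simpa [Nat.lt_succ_iff] using hk), mul_zero, zero_mul],
    show (6 : ZMod 2) = 0 from rfl, zero_pow hn]

end ModTwo

/-! ### Congruences modulo 3 for A, B, δ and F. -/

section ModThree

theorem A_mod_three (n : ℕ) : ((SecondKind.A.seq n : ℤ) : ZMod 3) = 2 ^ n := by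
  simp only [SecondKind.seq]
  push_cast
  simp only [ZMod.pow_card]
  exact_mod_cast congrArg (Nat.cast (R := ZMod 3)) (Nat.sum_range_choose n)

/-- C(3k,2k) = C(3k,k) = 3 C(3k-1,k-1). -/
theorem choose_three_mul_mod_three {k : ℕ} (hk : k ≠ 0) :
    (((3 * k).choose (2 * k) : ℕ) : ZMod 3) = 0 := by
  obtain ⟨k, rfl⟩ := Nat.exists_eq_succ_of_ne_zero hk
  rw [ZMod.natCast_eq_zero_iff]
  have h1 : (3 * (k + 1)).choose (2 * (k + 1)) = (3 * (k + 1)).choose (k + 1) :=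
    Nat.choose_symm_of_eq_add (by ring)
  have h2 := Nat.add_one_mul_choose_eq (3 * k + 2) k
  refine ⟨(3 * k + 2).choose k, ?_⟩
  rw [Nat.succ_eq_add_one, h1]
  refine Nat.eq_of_mul_eq_mul_right (Nat.succ_pos k) ?_
  rw [Nat.succ_eq_add_one, show 3 * (k + 1) = 3 * k + 2 + 1 by ring, ← h2]
  ring

/-- A different factor vanishes in each case: C(n,3k) for n < 3k, C(3k,2k) for n = 3k, the power of
3 for n > 3k. -/
theorem three_pow_mul_choose_mod_three {n : ℕ} (hn : n ≠ 0) (k : ℕ) :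
    (3 : ZMod 3) ^ (n - 3 * k) * (n.choose (3 * k) : ℕ) * ((3 * k).choose (2 * k) : ℕ) = 0 := by
  rcases lt_trichotomy n (3 * k) with h | h | h
  · simp [Nat.choose_eq_zero_of_lt h]
  · rw [choose_three_mul_mod_three (by omega), mul_zero]
  · rw [show (3 : ZMod 3) = 0 from rfl, zero_pow (by omega)]; simp

theorem B_mod_three (n : ℕ) : ((SecondKind.B.seq n : ℤ) : ZMod 3) = 3 ^ n := by
  rcases eq_or_ne n 0 with rfl | hn
  · decide
  simp only [SecondKind.seq]
  push_cast
  rw [show (3 : ZMod 3) ^ n = 0 by rw [show (3 : ZMod 3) = 0 from rfl, zero_pow hn]]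
  refine Finset.sum_eq_zero fun k _ => ?_
  linear_combination (exp := 1) (-1 : ZMod 3) ^ k * ((2 * k).choose k : ℕ)
    * three_pow_mul_choose_mod_three hn k

theorem delta_mod_three (n : ℕ) : ((FirstKind.delta.seq n : ℤ) : ZMod 3) = 3 ^ n := by
  rcases eq_or_ne n 0 with rfl | hn
  · decide
  simp only [FirstKind.seq]
  push_cast
  rw [show (3 : ZMod 3) ^ n = 0 by rw [show (3 : ZMod 3) = 0 from rfl, zero_pow hn]]
  refine Finset.sum_eq_zero fun k _ => ?_
  linear_combination (exp := 1) (-1 : ZMod 3) ^ k * ((2 * k).choose k : ℕ) * ((n + k).choose k : ℕ)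
    * three_pow_mul_choose_mod_three hn k

/-- Replacing the inner sum by 2^k, the binomial theorem gives (8 - 2)^n; modulo 3 this is the
expansion of (-1 + 1)^n. -/
theorem F_mod_three (n : ℕ) : ((SecondKind.F.seq n : ℤ) : ZMod 3) = 6 ^ n := by
  have hA := A_mod_three
  simp only [SecondKind.seq] at hA ⊢
  push_cast at hA ⊢
  simp only [hA, show (6 : ZMod 3) = 1 + -1 from rfl, add_pow, one_pow]
  refine Finset.sum_congr rfl fun k _ => ?_
  rw [show (8 : ZMod 3) = -1 from rfl, show (2 : ZMod 3) = -1 from rfl, mul_right_comm,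
    mul_right_comm _ _ ((-1 : ZMod 3) ^ k), ← mul_pow]
  simp

end ModThree

/-! ### Binomials with integer upper index: η and s_18. -/

section IntegerTop

theorem binomZ_natCast (m j : ℕ) : binomZ m j = m.choose j := by simp [binomZ]

theorem binomZ_of_neg {m : ℤ} (hm : m < 0) (j : ℕ) : binomZ m j = 0 := by
  simp [binomZ, not_le.2 hm]

theorem binomZ_add_one (m : ℤ) (j : ℕ) :
    binomZ (m + 1) (j + 1) = binomZ m j + binomZ m (j + 1) := by
  rcases lt_trichotomy m (-1) with h | rfl | h
  · rw [binomZ_of_neg (by omega), binomZ_of_neg (by omega), binomZ_of_neg (by omega), add_zero]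
  · simp [binomZ]
  · have h0 : 0 ≤ m := by omega
    lift m to ℕ using h0
    rw [show (m : ℤ) + 1 = (m + 1 : ℕ) by push_cast; rfl, binomZ_natCast, binomZ_natCast,
      binomZ_natCast, Nat.choose_succ_succ]
    push_cast; rfl

theorem mul_binomZ_sub_one {N : ℤ} (hN : N ≠ 0) (M : ℕ) :
    N * (binomZ (N - 1) M + binomZ N M) = (2 * N - M) * binomZ N M := by
  rcases lt_or_gt_of_ne hN with h | h
  · rw [binomZ_of_neg (by omega), binomZ_of_neg (by omega)]; ring
  · obtain ⟨m, rfl⟩ : ∃ m : ℕ, N = m + 1 := ⟨(N - 1).toNat, by omega⟩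
    have hc : ((m : ℤ) + 1) = ((m + 1 : ℕ) : ℤ) := by push_cast; rfl
    rw [add_sub_cancel_right, hc, binomZ_natCast, binomZ_natCast]
    rcases lt_or_ge (m + 1) M with h' | h'
    · rw [Nat.choose_eq_zero_of_lt h', Nat.choose_eq_zero_of_lt (by omega)]; simp
    · have := Nat.choose_mul_succ_eq m M
      zify [h'] at this
      push_cast
      linear_combination this

theorem cast_binomZ_lucas {p : ℕ} [Fact p.Prime] (q : ℤ) (i : ℕ) {r s : ℕ} (hr : r < p)
    (hs : s < p) :
    ((binomZ (p * q + r) (p * i + s) : ℤ) : ZMod p) = (binomZ q i : ℤ) * (r.choose s : ℕ) := by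
  rcases lt_or_ge q 0 with h | h
  · rw [binomZ_of_neg h, binomZ_of_neg (by nlinarith [Int.ofNat_lt.2 hr])]; simp
  · lift q to ℕ using h
    rw [show (p : ℤ) * q + r = (p * q + r : ℕ) by push_cast; rfl, binomZ_natCast, binomZ_natCast]
    have := lucas_choose q i hr hs
    exact_mod_cast this

theorem cast_binomZ_mul_prime {p : ℕ} [Fact p.Prime] (q : ℤ) (i : ℕ) :
    ((binomZ (p * q) (p * i) : ℤ) : ZMod p) = (binomZ q i : ℤ) := by
  have hp := (Fact.out : p.Prime).pos
  simpa using cast_binomZ_lucas (p := p) q i hp hp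

theorem cast_binomZ_mul_prime_sub_one {p : ℕ} [Fact p.Prime] (q : ℤ) (i : ℕ) :
    ((binomZ (p * q - 1) (p * i) : ℤ) : ZMod p) = (binomZ (q - 1) i : ℤ) := by
  have hp := (Fact.out : p.Prime).pos
  have := cast_binomZ_lucas (p := p) (q - 1) i (r := p - 1) (Nat.sub_lt hp Nat.one_pos) hp
  rw [show (p : ℤ) * (q - 1) + (p - 1 : ℕ) = p * q - 1 by push_cast [Nat.one_le_iff_ne_zero.2 hp.ne']; ring] at this
  simpa using this

/-- N times the sum equals (2N - M) C(N,M), and N is invertible. This makes the brackets in η (p =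
5) and s_18 (p = 3) vanish whenever p ∤ n. -/
theorem cast_binomZ_sub_one_add_binomZ {p : ℕ} [Fact p.Prime] {N : ℤ} {M : ℕ}
    (hN : (N : ZMod p) ≠ 0) (hM : (2 * N - M : ZMod p) = 0) :
    ((binomZ (N - 1) M : ℤ) : ZMod p) + (binomZ N M : ℤ) = 0 := by
  have h0 : N ≠ 0 := by rintro rfl; simp at hN
  have h := congrArg (Int.cast (R := ZMod p)) (mul_binomZ_sub_one h0 M)
  push_cast at h
  rw [hM, zero_mul] at h
  exact (mul_eq_zero.1 h).resolve_left hN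

/-- Dividing a positive n by p repeatedly ends at an index prime to p, where u vanishes. -/
theorem eq_zero_pow_of_mul_prime {p : ℕ} [Fact p.Prime] {u : ℕ → ZMod p} (h0 : u 0 = 1)
    (hu : ∀ m, u (p * m) = u m) (hz : ∀ n : ℕ, (n : ZMod p) ≠ 0 → u n = 0) (n : ℕ) :
    u n = 0 ^ n := by
  induction n using Nat.strong_induction_on with
  | _ n ih =>
    rcases eq_or_ne n 0 with rfl | hn
    · simpa using h0
    rw [zero_pow hn]
    by_cases h : (n : ZMod p) = 0
    · obtain ⟨m, rfl⟩ := (ZMod.natCast_eq_zero_iff _ _).1 h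
      have hm : m ≠ 0 := by rintro rfl; simp at hn
      rw [hu, ih m (by nlinarith [(Fact.out : p.Prime).two_le, Nat.pos_of_ne_zero hm]), zero_pow hm]
    · exact hz n h

/-- The digit factorisation with r = 0, the last-digit factor being the indicator of s = 0. -/
theorem sum_range_mul_prime {R : Type*} [CommSemiring R] {p m : ℕ} (hp : 0 < p) {h a : ℕ → R}
    (ha : ∀ j, h (p * j) = a j) (hz : ∀ j s, s < p → s ≠ 0 → h (p * j + s) = 0)
    (h0 : ∀ k, p * m < k → h k = 0) :
    ∑ k ∈ Finset.range (p * m + 1), h k = ∑ j ∈ Finset.range (m + 1), a j := by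
  have := sum_range_lucas (p := p) (m := m) (r := 0) (h := h) (a := a)
    (b := fun s => if s = 0 then 1 else 0) hp (fun j s hs => ?_) h0 (fun k hk => if_neg hk.ne')
  · simpa using this
  · rcases eq_or_ne s 0 with rfl | hs0
    · simp [ha]
    · simp [hs0, hz j s hs hs0]

theorem cast_choose_mul_prime {p : ℕ} [Fact p.Prime] (m j : ℕ) :
    (((p * m).choose (p * j) : ℕ) : ZMod p) = m.choose j := by
  have hp := (Fact.out : p.Prime).pos
  simpa using lucas_choose (p := p) m j hp hp

theorem cast_choose_mul_prime_of_ne {p : ℕ} [Fact p.Prime] (m j : ℕ) {s : ℕ} (hs : s < p)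
    (h0 : s ≠ 0) : (((p * m).choose (p * j + s) : ℕ) : ZMod p) = 0 := by
  have hp := (Fact.out : p.Prime).pos
  simpa [Nat.choose_eq_zero_of_lt (Nat.pos_of_ne_zero h0)] using lucas_choose (p := p) m j hp hs

theorem eta_mod_five (n : ℕ) : ((FirstKind.eta.seq n : ℤ) : ZMod 5) = 5 ^ n := by
  have h50 : (5 : ZMod 5) = 0 := rfl
  rw [h50]
  refine eq_zero_pow_of_mul_prime (p := 5) (u := fun n => ((FirstKind.eta.seq n : ℤ) : ZMod 5))
    (by decide) (fun m => ?_) (fun n hn => ?_) n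
  · simp only [FirstKind.seq]
    push_cast
    refine sum_range_mul_prime (by norm_num) (fun j => ?_) (fun j s hs h0 => ?_) fun k hk => ?_
    · rw [cast_choose_mul_prime (p := 5) m j]
      have h1 := cast_binomZ_mul_prime (p := 5) (4 * m - 5 * j) (3 * m)
      have h2 := cast_binomZ_mul_prime_sub_one (p := 5) (4 * m - 5 * j) (3 * m)
      rw [← h1, ← h2, pow_mul, show (-1 : ZMod 5) ^ 5 = -1 from rfl,
        show (4 * (5 * (m : ℤ)) - 5 * ((5 * j : ℕ) : ℤ)) = ((5 : ℕ) : ℤ) * (4 * m - 5 * j) by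
          push_cast; ring, mul_left_comm 3 5 m]
    · rw [cast_choose_mul_prime_of_ne (p := 5) m j hs h0]; simp
    · simp [Nat.choose_eq_zero_of_lt hk]
  · simp only [FirstKind.seq]
    push_cast
    refine Finset.sum_eq_zero fun k _ => ?_
    -- Here N = 4n - 5k and M = 3n, so N ≡ 4n and 2N - M = 5(n - 2k).
    rw [cast_binomZ_sub_one_add_binomZ (p := 5), mul_zero]
    · push_cast
      rw [h50, zero_mul, sub_zero]
      exact mul_ne_zero (by decide) hn
    · push_cast
      linear_combination ((n : ZMod 5) - 2 * k) * h50

theorem s18_mod_three (n : ℕ) : ((FirstKind.s18.seq n : ℤ) : ZMod 3) = 6 ^ n := by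
  have h30 : (3 : ZMod 3) = 0 := rfl
  rw [show (6 : ZMod 3) = 0 from rfl]
  refine eq_zero_pow_of_mul_prime (p := 3) (u := fun n => ((FirstKind.s18.seq n : ℤ) : ZMod 3))
    (by decide) (fun m => ?_) (fun n hn => ?_) n
  · simp only [FirstKind.seq]
    push_cast
    refine sum_range_mul_prime (by norm_num) (fun j => ?_) (fun j s hs h0 => ?_) fun k hk => ?_
    · have h1 := cast_binomZ_mul_prime (p := 3) (2 * m - 3 * j) m
      have h2 := cast_binomZ_mul_prime_sub_one (p := 3) (2 * m - 3 * j) m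
      have h3 := lucas_choose_mul_central_sub (p := 3) m j (r := 0) (s := 0) (by norm_num) (by norm_num)
      have h4 := lucas_central (p := 3) j (s := 0) (by norm_num)
      simp only [add_zero, mul_zero, Nat.choose_self, Nat.cast_one, mul_one, Nat.sub_zero] at h3 h4
      rw [← h1, ← h2, pow_mul, show (-1 : ZMod 3) ^ 3 = -1 from rfl,
        show (2 * (3 * (m : ℤ)) - 3 * ((3 * j : ℕ) : ℤ)) = ((3 : ℕ) : ℤ) * (2 * m - 3 * j) by
          push_cast; ring, h4]
      linear_combination (exp := 1) (-1 : ZMod 3) ^ j * ((2 * j).choose j : ℕ) *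
        (((binomZ (((3 : ℕ) : ℤ) * (2 * m - 3 * j) - 1) (3 * m) : ℤ) : ZMod 3) + 
          (binomZ (((3 : ℕ) : ℤ) * (2 * m - 3 * j)) (3 * m) : ℤ)) * h3
    · rw [cast_choose_mul_prime_of_ne (p := 3) m j hs h0]; simp
    · simp [Nat.choose_eq_zero_of_lt hk]
  · simp only [FirstKind.seq]
    push_cast
    refine Finset.sum_eq_zero fun k _ => ?_
    -- Here N = 2n - 3k and M = n, so N ≡ 2n and 2N - M = 3(n - 2k).
    rw [cast_binomZ_sub_one_add_binomZ (p := 3), mul_zero]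
    · push_cast
      rw [h30, zero_mul, sub_zero]
      exact mul_ne_zero (by decide) hn
    · push_cast
      linear_combination ((n : ZMod 3) - 2 * k) * h30

theorem cast_binomZ_sub_one_add_binomZ_mod_two (N : ℤ) (M : ℕ) :
    ((binomZ (N - 1) (M + 1) : ℤ) : ZMod 2) + (binomZ N (M + 1) : ℤ) = (binomZ (N - 1) M : ℤ) := by
  have h := binomZ_add_one (N - 1) M
  rw [sub_add_cancel] at h
  rw [h]
  push_cast
  linear_combination (exp := 1) ((binomZ (N - 1) (M + 1) : ℤ) : ZMod 2) * (CharTwo.two_eq_zero (R := ZMod 2))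

/-- Pascal's rule applied twice, the analogue of (1 + x)^2 = 1 + x^2 modulo 2. -/
theorem cast_binomZ_add_two_mod_two (N : ℤ) (M : ℕ) :
    ((binomZ (N + 2) (M + 2) : ℤ) : ZMod 2) + (binomZ N (M + 2) : ℤ) = (binomZ N M : ℤ) := by
  have h1 := binomZ_add_one (N + 1) (M + 1)
  rw [show N + 1 + 1 = N + 2 by ring, binomZ_add_one, binomZ_add_one] at h1
  rw [h1]
  push_cast
  linear_combination (exp := 1) (((binomZ N (M + 1) : ℤ) : ZMod 2) + (binomZ N (M + 2) : ℤ))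
    * (CharTwo.two_eq_zero (R := ZMod 2))

/-- The term of the sequence `η` modulo `2`, at a positive index. -/
def etaTermModTwo (n k : ℕ) : ZMod 2 :=
  (n.choose k : ZMod 2) * (binomZ (4 * n - 5 * k - 1) (3 * n - 1) : ℤ)

theorem eta_cast_eq_sum {n : ℕ} (hn : n ≠ 0) : ((FirstKind.eta.seq n : ℤ) : ZMod 2)
    = ∑ k ∈ Finset.range (n + 1), etaTermModTwo n k := by
  simp only [FirstKind.seq]
  push_cast
  refine Finset.sum_congr rfl fun k _ => ?_
  obtain ⟨M, hM⟩ : ∃ M, 3 * n = M + 1 := ⟨3 * n - 1, by omega⟩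
  rw [etaTermModTwo, pow_three_mod_two, hM, cast_binomZ_sub_one_add_binomZ_mod_two,
    show (-1 : ZMod 2) = 1 from rfl]
  simp

theorem sum_etaTermModTwo_even (m : ℕ) (hm : m ≠ 0) :
    ∑ k ∈ Finset.range (2 * m + 1), etaTermModTwo (2 * m) k
      = ∑ k ∈ Finset.range (m + 1), etaTermModTwo m k := by
  refine sum_range_mul_prime (by norm_num) (fun j => ?_) (fun j s hs h0 => ?_) fun k hk => ?_
  · have := cast_binomZ_lucas (p := 2) (4 * m - 5 * j - 1) (3 * m - 1) (r := 1) (s := 1)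
      (by norm_num) (by norm_num)
    rw [etaTermModTwo, etaTermModTwo, cast_choose_mul_prime (p := 2) m j]
    rw [Nat.choose_self, Nat.cast_one (R := ZMod 2), mul_one] at this
    rw [← this]
    congr 3
    · push_cast; ring
    · omega
  · rw [etaTermModTwo, cast_choose_mul_prime_of_ne (p := 2) m j hs h0, zero_mul]
  · simp [etaTermModTwo, Nat.choose_eq_zero_of_lt hk]

/-- The terms k = 2j and k = 2j + 1 reduce by Lucas to C(m,j) times C(N+2,M+2) and C(N,M+2), with N
= 4m - 5j - 1 and M = 3m - 1. Their sum is C(m,j) C(N,M). For m = 0 the subtraction in M would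
truncate. -/
theorem sum_etaTermModTwo_odd (m : ℕ) (hm : m ≠ 0) :
    ∑ k ∈ Finset.range (2 * m + 1 + 1), etaTermModTwo (2 * m + 1) k
      = ∑ k ∈ Finset.range (m + 1), etaTermModTwo m k := by
  have hs : ∀ M, ∑ k ∈ Finset.range (2 * M), etaTermModTwo (2 * m + 1) k
      = ∑ j ∈ Finset.range M, (etaTermModTwo (2 * m + 1) (2 * j)
        + etaTermModTwo (2 * m + 1) (2 * j + 1)) := by
    intro M
    induction M with
    | zero => simp
    | succ M ih =>
      rw [Finset.sum_range_succ, ← ih, mul_add, mul_one, Finset.sum_range_succ,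
        Finset.sum_range_succ, add_assoc]
  rw [show 2 * m + 1 + 1 = 2 * (m + 1) by ring, hs]
  refine Finset.sum_congr rfl fun j _ => ?_
  obtain ⟨M, hM⟩ : ∃ M, 3 * m - 1 = M := ⟨_, rfl⟩
  have h1 := lucas_choose (p := 2) m j (r := 1) (s := 0) (by norm_num) (by norm_num)
  have h2 := lucas_choose (p := 2) m j (r := 1) (s := 1) (by norm_num) (by norm_num)
  have h3 := cast_binomZ_lucas (p := 2) (4 * m - 5 * j - 1 + 2) (M + 2) (r := 1) (s := 0)
    (by norm_num) (by norm_num)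
  have h4 := cast_binomZ_lucas (p := 2) (4 * m - 5 * j - 1) (M + 2) (r := 0) (s := 0)
    (by norm_num) (by norm_num)
  simp only [Nat.choose_zero_right, Nat.choose_self, Nat.cast_one, mul_one, add_zero] at h1 h2 h3 h4
  rw [etaTermModTwo, etaTermModTwo, etaTermModTwo, h1, h2, hM,
    ← cast_binomZ_add_two_mod_two (4 * m - 5 * j - 1),
    ← h3, ← h4,
    show 3 * (2 * m + 1) - 1 = 2 * (M + 2) by omega]
  rw [show 4 * ((2 * m + 1 : ℕ) : ℤ) - 5 * (2 * j : ℕ) - 1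
      = (2 : ℕ) * (4 * m - 5 * j - 1 + 2) + 1 by push_cast; ring,
    show 4 * ((2 * m + 1 : ℕ) : ℤ) - 5 * (2 * j + 1 : ℕ) - 1
      = (2 : ℕ) * (4 * m - 5 * j - 1) + (0 : ℕ) by push_cast; ring,
    ← mul_add]

theorem eta_mod_two (n : ℕ) : ((FirstKind.eta.seq n : ℤ) : ZMod 2) = 5 ^ n := by
  rw [show (5 : ZMod 2) = 1 from rfl, one_pow]
  induction n using Nat.strong_induction_on with
  | _ n ih =>
    rcases eq_or_ne n 0 with rfl | hn
    · decide
    rcases eq_or_ne n 1 with rfl | h1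
    · decide
    have hm : n / 2 ≠ 0 := by omega
    rw [← ih (n / 2) (by omega), eta_cast_eq_sum hn, eta_cast_eq_sum hm]
    rcases Nat.mod_two_eq_zero_or_one n with h | h
    · rw [← sum_etaTermModTwo_even _ hm, show 2 * (n / 2) = n by omega]
    · rw [← sum_etaTermModTwo_odd _ hm, show 2 * (n / 2) + 1 = n by omega]

end IntegerTop

/-! ### Inverting the binomial transform modulo p. -/

section Transform

variable {p : ℕ} [Fact p.Prime] {u : ℕ → ℤ} {α : ℤ}

theorem cast_eq_pow_of_transform {N : ℕ} (h0 : u 0 = 1)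
    (h : ∀ i ∈ Finset.Icc 1 N, (p : ℤ) ∣ binomialTransform u i α) :
    ∀ i ≤ N, (u i : ZMod p) = (α : ZMod p) ^ i := by
  intro i
  induction i using Nat.strong_induction_on with
  | _ i ih =>
    intro hi
    rcases eq_or_ne i 0 with rfl | hi0
    · simp [h0]
    have hz := (ZMod.intCast_zmod_eq_zero_iff_dvd _ p).2
      (h i (Finset.mem_Icc.2 ⟨Nat.one_le_iff_ne_zero.2 hi0, hi⟩))
    -- The expansion of (α - α)^i = 0 agrees with that of v_i(α) in all terms k < i by induction, so
    -- the last terms agree as well.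
    have hs := add_pow (α : ZMod p) (-α) i
    rw [add_neg_cancel, zero_pow hi0, Finset.sum_range_succ] at hs
    rw [binomialTransform, Finset.sum_range_succ] at hz
    push_cast at hz
    have hc : ∑ k ∈ Finset.range i, (i.choose k : ZMod p) * (-α) ^ (i - k) * (u k : ZMod p)
        = ∑ k ∈ Finset.range i, (α : ZMod p) ^ k * (-α) ^ (i - k) * (i.choose k : ZMod p) :=
      Finset.sum_congr rfl fun k hk => by
        rw [ih k (Finset.mem_range.1 hk) (by have := Finset.mem_range.1 hk; omega)]; ring
    rw [hc] at hz
    simp only [Nat.choose_self, Nat.sub_self, pow_zero, mul_one, one_mul, Nat.cast_one] at hz hs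
    linear_combination hz + hs

/-- A prime dividing the first few values of the transform divides each `u i - u 1 ^ i`. -/
theorem natCast_dvd_sub_pow {N : ℕ} (h0 : u 0 = 1) (hN : 1 ≤ N)
    (h : ∀ i ∈ Finset.Icc 1 N, (p : ℤ) ∣ binomialTransform u i α) {i : ℕ} (hi : i ≤ N) :
    (p : ℤ) ∣ u i - u 1 ^ i := by
  have hu := cast_eq_pow_of_transform h0 h
  rw [← ZMod.intCast_zmod_eq_zero_iff_dvd]
  push_cast
  rw [hu i hi, hu 1 hN, pow_one, sub_self]

end Transform

/-! ### The admissible primes and the passage to square-free moduli. -/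

theorem SecondKind.seq_zero (t : SecondKind) : t.seq 0 = 1 := by cases t <;> decide

theorem FirstKind.seq_zero (t : FirstKind) : t.seq 0 = 1 := by cases t <;> decide

theorem eq_of_dvd_int {p : ℕ} (hp : p.Prime) {a : ℕ} (ha : a.Prime) (i : ℕ) {z : ℤ}
    (hz : z.natAbs = a ^ i) (h : (p : ℤ) ∣ z) : p = a :=
  (Nat.prime_dvd_prime_iff_eq hp ha).1 (hp.dvd_of_dvd_pow (hz ▸ Int.natCast_dvd.1 h))

theorem eq_or_eq_of_dvd_int {p : ℕ} (hp : p.Prime) {a b : ℕ} (ha : a.Prime) (hb : b.Prime)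
    (i j : ℕ) {z : ℤ} (hz : z.natAbs = a ^ i * b ^ j) (h : (p : ℤ) ∣ z) : p = a ∨ p = b := by
  rcases hp.dvd_mul.1 (hz ▸ Int.natCast_dvd.1 h) with h | h
  · exact .inl ((Nat.prime_dvd_prime_iff_eq hp ha).1 (hp.dvd_of_dvd_pow h))
  · exact .inr ((Nat.prime_dvd_prime_iff_eq hp hb).1 (hp.dvd_of_dvd_pow h))

theorem SecondKind.cast_seq (t : SecondKind) {p : ℕ} [Fact p.Prime]
    (h : ∀ i ≤ 3, (p : ℤ) ∣ t.seq i - t.seq 1 ^ i) (n : ℕ) :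
    (t.seq n : ZMod p) = (t.seq 1 : ZMod p) ^ n := by
  have hp : p.Prime := Fact.out
  have h2 := h 2 (by norm_num)
  have h3 := h 3 (by norm_num)
  cases t
  · rw [show SecondKind.A.seq 1 = 2 by decide]
    rcases eq_or_eq_of_dvd_int hp Nat.prime_two Nat.prime_three 1 1 (by decide) h2 with rfl | rfl
    · exact A_mod_two n
    · exact A_mod_three n
  · rw [show SecondKind.B.seq 1 = 3 by decide]
    -- For B, u_2 = u_1^2, so only index 3 restricts p: u_3 - u_1^3 = -6.
    rcases eq_or_eq_of_dvd_int hp Nat.prime_two Nat.prime_three 1 1 (by decide) h3 with rfl | rfl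
    · exact B_mod_two n
    · exact B_mod_three n
  · rw [show SecondKind.C.seq 1 = 3 by decide]
    rcases eq_or_eq_of_dvd_int hp Nat.prime_two Nat.prime_three 1 1 (by decide) h2 with rfl | rfl
    · exact C_mod_two n
    · exact C_mod_three n
  · rw [show SecondKind.D.seq 1 = 3 by decide]
    rcases eq_or_eq_of_dvd_int hp Nat.prime_two Nat.prime_five 1 1 (by decide) h2 with rfl | rfl
    · exact D_mod_two n
    · exact D_mod_five n
  · rw [show SecondKind.E.seq 1 = 4 by decide]
    obtain rfl := eq_of_dvd_int hp Nat.prime_two 2 (by decide) h2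
    exact E_mod_two n
  · rw [show SecondKind.F.seq 1 = 6 by decide]
    rcases eq_or_eq_of_dvd_int hp Nat.prime_two Nat.prime_three 1 1 (by decide) h2 with rfl | rfl
    · exact F_mod_two n
    · exact F_mod_three n

theorem FirstKind.cast_seq (t : FirstKind) {p : ℕ} [Fact p.Prime]
    (h : ∀ i ≤ 4, (p : ℤ) ∣ t.seq i - t.seq 1 ^ i) (n : ℕ) :
    (t.seq n : ZMod p) = (t.seq 1 : ZMod p) ^ n := by
  have hp : p.Prime := Fact.out
  have h2 := h 2 (by norm_num)
  have h3 := h 3 (by norm_num)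
  cases t
  · rw [show FirstKind.delta.seq 1 = 3 by decide]
    -- Again u_2 = u_1^2; here u_3 - u_1^3 = -24.
    rcases eq_or_eq_of_dvd_int hp Nat.prime_two Nat.prime_three 3 1 (by decide) h3 with rfl | rfl
    · exact delta_mod_two n
    · exact delta_mod_three n
  · rw [show FirstKind.eta.seq 1 = 5 by decide]
    rcases eq_or_eq_of_dvd_int hp Nat.prime_two Nat.prime_five 1 1 (by decide) h2 with rfl | rfl
    · exact eta_mod_two n
    · exact eta_mod_five n
  · rw [show FirstKind.alpha.seq 1 = 4 by decide]
    rcases eq_or_eq_of_dvd_int hp Nat.prime_two Nat.prime_three 2 1 (by decide) h2 with rfl | rfl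
    · exact alpha_mod_two n
    · exact alpha_mod_three n
  · rw [show FirstKind.epsilon.seq 1 = 4 by decide]
    rcases eq_or_eq_of_dvd_int hp Nat.prime_two Nat.prime_three 3 1 (by decide) h2 with rfl | rfl
    · exact epsilon_mod_two n
    · exact epsilon_mod_three n
  · rw [show FirstKind.zeta.seq 1 = 3 by decide]
    rcases eq_or_eq_of_dvd_int hp Nat.prime_two Nat.prime_three 1 2 (by decide) h2 with rfl | rfl
    · exact zeta_mod_two n
    · exact zeta_mod_three n
  · rw [show FirstKind.gamma.seq 1 = 5 by decide]
    rcases eq_or_eq_of_dvd_int hp Nat.prime_two Nat.prime_three 4 1 (by decide) h2 with rfl | rfl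
    · exact gamma_mod_two n
    · exact gamma_mod_three n
  · rw [show FirstKind.s7.seq 1 = 4 by decide]
    obtain rfl := eq_of_dvd_int hp Nat.prime_two 5 (by decide) h2
    exact s7_mod_two n
  · rw [show FirstKind.s10.seq 1 = 2 by decide]
    have hd : (p : ℤ) ∣ 2 := by
      have := dvd_sub h3 (h2.mul_left 11)
      rwa [show FirstKind.s10.seq 3 - FirstKind.s10.seq 1 ^ 3
        - 11 * (FirstKind.s10.seq 2 - FirstKind.s10.seq 1 ^ 2) = 2 by decide] at this
    obtain rfl := eq_of_dvd_int hp Nat.prime_two 1 (by decide) hd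
    exact s10_mod_two n
  · rw [show FirstKind.s18.seq 1 = 6 by decide]
    rcases eq_or_eq_of_dvd_int hp Nat.prime_two Nat.prime_three 1 2 (by decide) h2 with rfl | rfl
    · exact s18_mod_two n
    · exact s18_mod_three n

theorem AperyLike.modEq_of_prime_dvd_M (s : AperyLike) (α : ℤ) (n : ℕ) {p : ℕ} (hp : p.Prime)
    (h : p ∣ s.M α) : (p : ℤ) ∣ s.seq n - α ^ n := by
  have : Fact p.Prime := ⟨hp⟩
  rw [← ZMod.intCast_zmod_eq_zero_iff_dvd]
  push_cast
  rw [sub_eq_zero]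
  cases s with
  | second t =>
    have h' : ∀ i ∈ Finset.Icc 1 3, (p : ℤ) ∣ binomialTransform t.seq i α := fun i hi =>
      Int.natCast_dvd.2 (Finset.dvd_gcd_iff.1 h i hi)
    have hα := cast_eq_pow_of_transform t.seq_zero h' 1 (by norm_num)
    rw [pow_one] at hα
    rw [← hα]
    exact t.cast_seq (fun i hi => natCast_dvd_sub_pow t.seq_zero (by norm_num) h' hi) n
  | first t =>
    have h' : ∀ i ∈ Finset.Icc 1 4, (p : ℤ) ∣ binomialTransform t.seq i α := fun i hi =>
      Int.natCast_dvd.2 (Finset.dvd_gcd_iff.1 h i hi)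
    have hα := cast_eq_pow_of_transform t.seq_zero h' 1 (by norm_num)
    rw [pow_one] at hα
    rw [← hα]
    exact t.cast_seq (fun i hi => natCast_dvd_sub_pow t.seq_zero (by norm_num) h' hi) n

theorem squarefreeFactor_mem {M : ℕ} (hM : M ≠ 0) :
    squarefreeFactor M ∣ M ∧ Squarefree (squarefreeFactor M) := by
  have hne : (M.divisors.filter Squarefree).Nonempty :=
    ⟨1, by simp [hM]⟩
  obtain ⟨d, hd, he⟩ := Finset.exists_mem_eq_sup _ hne id
  rw [squarefreeFactor, he]
  simp only [Finset.mem_filter, Nat.mem_divisors] at hd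
  exact ⟨hd.1.1, hd.2⟩

theorem natCast_dvd_of_squarefree {d : ℕ} (hd : Squarefree d) {x : ℤ}
    (h : ∀ p : ℕ, p.Prime → p ∣ d → (p : ℤ) ∣ x) : (d : ℤ) ∣ x := by
  rw [Int.natCast_dvd, ← Nat.prod_primeFactors_of_squarefree hd]
  refine Finset.prod_primes_dvd _ (fun p hp => (Nat.prime_of_mem_primeFactors hp).prime)
    fun p hp => Int.natCast_dvd.1 (h p (Nat.prime_of_mem_primeFactors hp)
      (Nat.dvd_of_mem_primeFactors hp))

/-- Needed because 0 has an empty `Nat.divisors`. If M_α were 0, every prime would divide it,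
including 7; but for no sequence does 7 divide both u_2 - u_1^2 and u_3 - u_1^3. -/
theorem AperyLike.M_ne_zero (s : AperyLike) (α : ℤ) : s.M α ≠ 0 := by
  intro h0
  have : Fact (Nat.Prime 7) := ⟨by norm_num⟩
  cases s with
  | second t =>
    have h' : ∀ i ∈ Finset.Icc 1 3, ((7 : ℕ) : ℤ) ∣ binomialTransform t.seq i α := fun i hi =>
      Int.natCast_dvd.2 (by rw [Finset.gcd_eq_zero_iff.1 h0 i hi]; exact dvd_zero _)
    have h2 := natCast_dvd_sub_pow t.seq_zero (by norm_num) h' (i := 2) (by norm_num)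
    have h3 := natCast_dvd_sub_pow t.seq_zero (by norm_num) h' (i := 3) (by norm_num)
    revert h2 h3
    clear h' h0
    cases t <;> decide
  | first t =>
    have h' : ∀ i ∈ Finset.Icc 1 4, ((7 : ℕ) : ℤ) ∣ binomialTransform t.seq i α := fun i hi =>
      Int.natCast_dvd.2 (by rw [Finset.gcd_eq_zero_iff.1 h0 i hi]; exact dvd_zero _)
    have h2 := natCast_dvd_sub_pow t.seq_zero (by norm_num) h' (i := 2) (by norm_num)
    have h3 := natCast_dvd_sub_pow t.seq_zero (by norm_num) h' (i := 3) (by norm_num)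
    revert h2 h3
    clear h' h0
    cases t <;> decide

theorem theorem1 (s : AperyLike) (α : ℤ) (n : ℕ) :
    s.seq n ≡ α ^ n [ZMOD (squarefreeFactor (s.M α) : ℤ)] := by
  have h := squarefreeFactor_mem (s.M_ne_zero α)
  refine (Int.modEq_iff_dvd.2 ?_).symm
  exact natCast_dvd_of_squarefree h.2 fun p hp hpd =>
    s.modEq_of_prime_dvd_M α n hp (hpd.trans h.1)
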